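/- Let $n\ge 0$ and let $\mathcal H$ be a finite-dimensional complex Hilbert space carrying operators $a_1,\dots,a_n$ that satisfy the canonical anticommutation relations $\{a_i^\dagger,a_j\}=\delta_{ij}\mathbb 1$, $\{a_i^\dagger,a_j^\dagger\}=0$, with a unit vector $|0\rangle$ (the vacuum) that is, up to scalars, the unique vector annihilated by all $a_i$. For $f,g\in\mathbb C^n$ put $a(f)=\sum_i \overline{f_i}\,a_i$ and $a^\dagger(g)=\sum_i g_i a_i^\dagger$. Let $M$ be a Hermitian positive-definite $n\times n$ matrix (the reduced metric), and let $\eta$ be the total metric that it induces, i.e. the operator on $\mathcal H$ with $\eta a_i^\dagger=\sum_j M_{ji}a_j^\dagger\eta$ for all $i$ and $\eta|0\rangle=|0\rangle$. An operator $O$ is quasi-Hermitian (an observable) if $\eta O=O^\dagger\eta$. For $S\subseteq[n]=\{1,\dots,n\}$, $O$ is Bravyi–Kitaev local to $S$ if it is a linear combination of products $\bigl(\prod_{i\in S_1}a_i^\dagger\bigr)\bigl(\prod_{j\in S_2}a_j\bigr)$ with $S_1,S_2\subseteq S$ and $|S_1|+|S_2|$ even; it is extensively local over $S$ if, moreover,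 it is not Bravyi–Kitaev local to any proper subset of $S$. Write $S'=[n]\setminus S$, let $M^{BC}$ be the block $(M_{ij})_{i\in B,\,j\in C}$, acting on $\mathbb C^C=\operatorname{span}\{e_i:i\in C\}\subseteq\mathbb C^n$, and put $K(S)=\dim\ker M^{S'S}$. Let $A\subseteq[n]$. Then: (1) There exists a quasi-Hermitian operator that is Bravyi–Kitaev extensively local over $A$ if and only if $K(A)>K(S)$ for every proper subset $S\subset A$. (2) Let $\{w^\mu : \mu\in[K(A)]\}$ be any basis of $\ker M^{A'A}$. An operator $O$ is both Bravyi–Kitaev local to $A$ and quasi-Hermitian if and only if it can be written as $$O=\sum_{S_1,S_2\subseteq[K(A)]}O_{S_1S_2}\Bigl(\prod_{\mu\in S_1}a^\dagger(w^\mu)\Bigr)\Bigl(\prod_{\nu\in S_2}a(M^{AA}w^\nu)\Bigr)$$ with complex coefficients such that $O_{S_1S_2}=O_{S_2S_1}^*$ for all $S_1,S_2$ and $O_{S_1S_2}=0$ whenever $|S_1|+|S_2|$ is odd. Here the creation factors are ordered by increasing $\mu$ and the annihilation factors by decreasing $\nu$. -/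

import Mathlib

open scoped ComplexOrder

/-- A representation of the canonical anticommutation relations for `n` fermionic modes on a
finite-dimensional complex Hilbert space `H`, with a unique vacuum.  The creation operators are
the adjoints of the annihilation operators `a i`. -/
structure FermionRep (n : ℕ) (H : Type*) [NormedAddCommGroup H] [InnerProductSpace ℂ H]
    [FiniteDimensional ℂ H] where
  /-- the annihilation operators -/
  a : Fin n → Module.End ℂ H
  /-- `{a†_i, a_j} = δ_ij 1` -/
  anticomm_adjoint : ∀ i j,
    LinearMap.adjoint (a i) * a j + a j * LinearMap.adjoint (a i) = if i = j then 1 else 0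
  /-- `{a†_i, a†_j} = 0` -/
  anticomm_adjoint_adjoint : ∀ i j,
    LinearMap.adjoint (a i) * LinearMap.adjoint (a j)
      + LinearMap.adjoint (a j) * LinearMap.adjoint (a i) = 0
  /-- the vacuum state -/
  vac : H
  norm_vac : ‖vac‖ = 1
  a_vac : ∀ i, a i vac = 0
  /-- every state annihilated by all `a i` is a multiple of the vacuum -/
  vac_unique : ∀ ψ : H, (∀ i, a i ψ = 0) → ∃ c : ℂ, ψ = c • vac

/-- The product of the `x i`, `i ∈ S`, with the factors in increasing order of `i`. -/
def prodIncr {R : Type*} [Monoid R] {m : ℕ} (S : Finset (Fin m)) (x : Fin m → R) : R :=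
  (S.sort.map x).prod

/-- The product of the `x i`, `i ∈ S`, with the factors in decreasing order of `i`. -/
def prodDecr {R : Type*} [Monoid R] {m : ℕ} (S : Finset (Fin m)) (x : Fin m → R) : R :=
  (S.sort.reverse.map x).prod

/-- `O` is an observable with respect to the metric `η`: `η O = O† η`. -/
def IsQuasiHermitian {H : Type*} [NormedAddCommGroup H] [InnerProductSpace ℂ H]
    [FiniteDimensional ℂ H] (η O : Module.End ℂ H) : Prop :=
  η * O = LinearMap.adjoint O * η

namespace FermionRep

section

variable {n : ℕ} {H : Type*} [NormedAddCommGroup H] [InnerProductSpace ℂ H]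
  [FiniteDimensional ℂ H]

/-- The creation operator `a†_i`. -/
noncomputable def aDag (F : FermionRep n H) (i : Fin n) : Module.End ℂ H :=
  LinearMap.adjoint (F.a i)

/-- The smeared annihilation operator `a(f) = ∑ i, conj (f i) a_i`. -/
noncomputable def annih (F : FermionRep n H) (f : Fin n → ℂ) : Module.End ℂ H :=
  ∑ i, star (f i) • F.a i

/-- The smeared creation operator `a†(g) = ∑ i, g i a†_i`. -/
noncomputable def create (F : FermionRep n H) (g : Fin n → ℂ) : Module.End ℂ H :=
  ∑ i, g i • F.aDag i

/-- `η` is the total metric induced by the reduced metric `M`: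
`η a†_i = ∑ j, M_ji a†_j η` and `η |0⟩ = |0⟩`. -/
def IsTotalMetric (F : FermionRep n H) (M : Matrix (Fin n) (Fin n) ℂ)
    (η : Module.End ℂ H) : Prop :=
  (∀ i, η * F.aDag i = ∑ j, M j i • (F.aDag j * η)) ∧ η F.vac = F.vac

/-- Bravyi–Kitaev locality: `O` is a linear combination of even products of creation and
annihilation operators with indices in `S`. -/
def IsBKLocal (F : FermionRep n H) (S : Finset (Fin n)) (O : Module.End ℂ H) : Prop :=
  O ∈ Submodule.span ℂ {P : Module.End ℂ H | ∃ S₁ S₂ : Finset (Fin n),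
    S₁ ⊆ S ∧ S₂ ⊆ S ∧ Even (S₁.card + S₂.card) ∧
      P = prodIncr S₁ F.aDag * prodDecr S₂ F.a}

/-- Extensive Bravyi–Kitaev locality over `A`: local to `A` and to no proper subset of `A`. -/
def IsBKExtensivelyLocal (F : FermionRep n H) (A : Finset (Fin n)) (O : Module.End ℂ H) : Prop :=
  F.IsBKLocal A O ∧ ∀ S, S ⊂ A → ¬ F.IsBKLocal S O

end

end FermionRep

/-- The block `M^{A'A}`, with rows outside `A` and columns in `A`. -/
def offBlock {n : ℕ} (M : Matrix (Fin n) (Fin n) ℂ) (A : Finset (Fin n)) :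
    Matrix {i : Fin n // i ∉ A} {j : Fin n // j ∈ A} ℂ :=
  M.submatrix Subtype.val Subtype.val

/-- The block `M^{AA}`. -/
def diagBlock {n : ℕ} (M : Matrix (Fin n) (Fin n) ℂ) (A : Finset (Fin n)) :
    Matrix {i : Fin n // i ∈ A} {j : Fin n // j ∈ A} ℂ :=
  M.submatrix Subtype.val Subtype.val

/-- `ker M^{A'A}`, a subspace of `ℂ^A`. -/
def offKer {n : ℕ} (M : Matrix (Fin n) (Fin n) ℂ) (A : Finset (Fin n)) :
    Submodule ℂ ({j : Fin n // j ∈ A} → ℂ) :=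
  LinearMap.ker (offBlock M A).mulVecLin

/-- `K(A) = dim ker M^{A'A}`. -/
noncomputable def kerDim {n : ℕ} (M : Matrix (Fin n) (Fin n) ℂ) (A : Finset (Fin n)) : ℕ :=
  Module.finrank ℂ (offKer M A)

/-- The inclusion `ℂ^A = span {e_i : i ∈ A} ⊆ ℂ^n`: extension by zero. -/
def extendZero {n : ℕ} (A : Finset (Fin n)) (v : {i : Fin n // i ∈ A} → ℂ) : Fin n → ℂ :=
  fun i => if h : i ∈ A then v ⟨i, h⟩ else 0

/-!
The proof rests on two descriptions of the operators local to `A`.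

On the one hand, locality is a commutation property (`FermionRep.isBKLocal_iff`): `O` is local to
`A` exactly when it commutes with the fermion parity and with `a_i`, `a†_i` for `i ∉ A`.  More
generally (`FermionRep.mem_evenNormalSpan`), an even operator commuting with every `a(f)` and
`a†(g)` with `f` and `g` orthogonal to given families `w` and `u` is a combination of even
normally ordered monomials in the `a†(w i)` and the annihilators of the `u i`.  The
reason is that the space of operators on `H` is again a Fock space: its vacuum is the identity, its
annihilators are the graded commutators with the generators and its creators are the left and
(twisted) right multiplications.  The general Fock space argument
`mem_of_forall_annihilated` is used twice, once on `H` for the cyclicity of the vacuum and once on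
the operators.

On the other hand, `η` conjugates `a†(g)` to `a†(M g)` and `a(M f)` to `a(f)`; the second relation
follows from the first by cyclicity of the vacuum (`FermionRep.IsTotalMetric.lower_mul`).  If `O` is
local to `A` and quasi-Hermitian, then `O = η⁻¹ O† η`, where `O†` is local to `A` too.  Hence `O`
commutes not only with the generators outside `A` but also with their conjugates by `η`, and by
duality with every `a(f)`, `a†(g)` for which `f` and `g` are orthogonal to `V` and to `M V`, where
`V = ℂ^A ∩ M⁻¹ ℂ^A` is the copy `localKer M A` of `ker M^{A'A}` inside `ℂ^n`
(`FermionRep.IsBKLocal.commute_of_isQuasiHermitian`).  So `O` is a combination of the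
monomials in `a†(w)` and `a(M w)` with `w` in a basis of `V`; and since
`η` carries such a monomial to the adjoint of the one with the index sets exchanged, the
coefficients can be averaged to be Hermitian.

The commutation property involves `A` only through `V`, so an observable local to `A` is local to any
`S ⊆ A` with the same local kernel, which is the case as soon as `K(S) = K(A)`.  Conversely the
observable `∑ μ, a†(w μ) a(M w μ)` is local to no `S` with a smaller kernel, because it
determines `V`.
-/

/-! ### Anticommuting families in a ring -/

section Anticommuting

variable {R ι : Type*} [Ring R]

/-- Reordering a product of anticommuting factors changes it by at most a sign. -/
lemma List.Perm.prod_map_eq_or_eq_neg {x : ι → R} (hx : ∀ i j, x i * x j = -(x j * x i))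
    {l₁ l₂ : List ι} (h : l₁.Perm l₂) :
    (l₁.map x).prod = (l₂.map x).prod ∨ (l₁.map x).prod = -(l₂.map x).prod := by
  induction h with
  | nil => simp
  | cons i _ ih =>
    rcases ih with ih | ih
    · left; simp [ih]
    · right; simp [ih]
  | swap i j l =>
    right
    simp only [List.map_cons, List.prod_cons, ← mul_assoc]
    rw [hx j i]; simp
  | trans _ _ ih₁ ih₂ =>
    rcases ih₁ with h₁ | h₁ <;> rcases ih₂ with h₂ | h₂ <;> simp [h₁, h₂]

lemma mul_list_prod_map_of_anticomm {x : ι → R} {y : R} {l : List ι}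
    (h : ∀ i ∈ l, y * x i = -(x i * y)) :
    y * (l.map x).prod = (-1) ^ l.length * ((l.map x).prod * y) := by
  induction l with
  | nil => simp
  | cons i l ih =>
    have hi := h i (by simp)
    have ih := ih fun j hj => h j (by simp [hj])
    have hc : Commute (x i) ((-1 : R) ^ l.length) := (Commute.neg_one_right _).pow_right _
    simp only [List.map_cons, List.prod_cons, List.length_cons, pow_succ, mul_assoc]
    rw [← mul_assoc y, hi, neg_mul, mul_assoc, ih, ← mul_assoc (x i), hc.eq]
    simp [mul_assoc]

lemma semiconj_list_prod_map {x y : ι → R} {z : R} (h : ∀ i, z * x i = y i * z) (l : List ι) :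
    z * (l.map x).prod = (l.map y).prod * z := by
  induction l with
  | nil => simp
  | cons i l ih =>
    simp only [List.map_cons, List.prod_cons]
    rw [← mul_assoc, h, mul_assoc, ih, mul_assoc]

variable {m : ℕ}

lemma mul_prodIncr_eq {x : Fin m → R} (hx : ∀ i j, x i * x j = -(x j * x i))
    (hxx : ∀ i, x i * x i = 0) (i : Fin m) (S : Finset (Fin m)) :
    x i * prodIncr S x = 0 ∨ x i * prodIncr S x = prodIncr (insert i S) x ∨
      x i * prodIncr S x = -prodIncr (insert i S) x := by
  unfold prodIncr
  by_cases hi : i ∈ S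
  · left
    have hp : S.sort.Perm (i :: (S.erase i).sort) := by
      rw [List.perm_ext_iff_of_nodup (Finset.sort_nodup _ _) (by simp)]
      intro j
      by_cases hj : j = i <;> simp [hj, hi]
    rcases hp.prod_map_eq_or_eq_neg hx with h | h <;> rw [h] <;> simp [← mul_assoc, hxx]
  · right
    have hp : (i :: S.sort).Perm (insert i S).sort := by
      rw [List.perm_ext_iff_of_nodup (by simp [hi]) (Finset.sort_nodup _ _)]
      intro j; simp
    simpa using hp.prod_map_eq_or_eq_neg hx

lemma prodDecr_mul_eq {x : Fin m → R} (hx : ∀ i j, x i * x j = -(x j * x i))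
    (hxx : ∀ i, x i * x i = 0) (i : Fin m) (S : Finset (Fin m)) :
    prodDecr S x * x i = 0 ∨ prodDecr S x * x i = prodDecr (insert i S) x ∨
      prodDecr S x * x i = -prodDecr (insert i S) x := by
  unfold prodDecr
  by_cases hi : i ∈ S
  · left
    have hp : S.sort.reverse.Perm ((S.erase i).sort ++ [i]) := by
      rw [List.perm_ext_iff_of_nodup (by simp) (by simp +contextual [List.nodup_append])]
      intro j
      by_cases hj : j = i <;> simp [hj, hi]
    rcases hp.prod_map_eq_or_eq_neg hx with h | h <;> rw [h] <;> simp [mul_assoc, hxx]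
  · right
    have hp : (S.sort.reverse ++ [i]).Perm (insert i S).sort.reverse := by
      rw [List.perm_ext_iff_of_nodup (by simp [List.nodup_append, hi]) (by simp)]
      intro j; simp [or_comm]
    simpa using hp.prod_map_eq_or_eq_neg hx

/-- An element that anticommutes with every factor of a normally ordered monomial passes through it
at the cost of the sign given by the degree. -/
lemma mul_monomial_of_anticomm {x y : Fin m → R} {z : R} {S₁ S₂ : Finset (Fin m)}
    (h₁ : ∀ i ∈ S₁, z * x i = -(x i * z)) (h₂ : ∀ i ∈ S₂, z * y i = -(y i * z)) :
    z * (prodIncr S₁ x * prodDecr S₂ y) =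
      (-1) ^ (S₁.card + S₂.card) * (prodIncr S₁ x * prodDecr S₂ y * z) := by
  have e₁ := mul_list_prod_map_of_anticomm (x := x) (y := z) (l := S₁.sort) (by simpa using h₁)
  have e₂ := mul_list_prod_map_of_anticomm (x := y) (y := z) (l := S₂.sort.reverse)
    (by simpa using h₂)
  have hc : Commute (prodIncr S₁ x) ((-1 : R) ^ S₂.card) := (Commute.neg_one_right _).pow_right _
  simp only [List.length_reverse, Finset.length_sort] at e₁ e₂
  change z * prodIncr S₁ x = _ * (prodIncr S₁ x * z) at e₁
  change z * prodDecr S₂ y = _ * (prodDecr S₂ y * z) at e₂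
  rw [← mul_assoc, e₁, mul_assoc, mul_assoc, e₂, ← mul_assoc (prodIncr S₁ x), hc.eq, pow_add]
  simp only [mul_assoc]

lemma parity_conj_monomial {x y : Fin m → R} {P : R} (hP : P * P = 1)
    (hx : ∀ i, P * x i = -(x i * P)) (hy : ∀ i, P * y i = -(y i * P)) (S₁ S₂ : Finset (Fin m)) :
    P * (prodIncr S₁ x * prodDecr S₂ y) * P =
      (-1) ^ (S₁.card + S₂.card) * (prodIncr S₁ x * prodDecr S₂ y) := by
  rw [mul_monomial_of_anticomm (fun i _ => hx i) (fun i _ => hy i), mul_assoc,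
    mul_assoc (prodIncr S₁ x * prodDecr S₂ y), hP, mul_one]

end Anticommuting

/-! ### An abstract Fock space argument -/

/-- Let `d` be anticommuting annihilators, some of which, `d (f i)`, are dual to creators `c i`,
while those in `B` anticommute with the `c i`.  A state killed by `B` is obtained by applying
the `c i` to states killed by `B` and all `d (f i)`.  The step uses
`ψ = d (f i) (c i ψ) + c i (d (f i) ψ)`. -/
lemma mem_of_forall_annihilated {E X ι : Type*} [AddCommGroup E] [Module ℂ E] [Finite ι]
    {d : X → Module.End ℂ E} {c : ι → Module.End ℂ E} {f : ι → X} {B : Set X}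
    {K : Submodule ℂ E}
    (hdd : ∀ x y ψ, d x (d y ψ) = -d y (d x ψ))
    (hB : ∀ x ∈ B, ∀ i ψ, d x (c i ψ) = -c i (d x ψ))
    (hself : ∀ i ψ, d (f i) (c i ψ) = ψ - c i (d (f i) ψ))
    (hne : ∀ i j, i ≠ j → ∀ ψ, d (f i) (c j ψ) = -c j (d (f i) ψ))
    (hK : ∀ i, ∀ ψ ∈ K, c i ψ ∈ K)
    (hvac : ∀ ψ, (∀ x ∈ B, d x ψ = 0) → (∀ i, d (f i) ψ = 0) → ψ ∈ K)
    (ψ : E) (hψ : ∀ x ∈ B, d x ψ = 0) : ψ ∈ K := by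
  classical
  have := Fintype.ofFinite ι
  have key : ∀ (T : Finset ι) (ψ : E), (∀ x ∈ B, d x ψ = 0) → (∀ i ∉ T, d (f i) ψ = 0) →
      ψ ∈ K := by
    intro T
    induction T using Finset.induction_on with
    | empty => exact fun ψ h₁ h₂ => hvac ψ h₁ fun i => h₂ i (by simp)
    | insert i T hi ih =>
      intro ψ h₁ h₂
      have hdd0 : ∀ x, d x (d x ψ) = 0 := fun x => by
        have h := hdd x x ψ
        rw [eq_neg_iff_add_eq_zero, ← two_smul ℂ] at h
        simpa using h
      have e : ψ = d (f i) (c i ψ) + c i (d (f i) ψ) := by rw [hself]; abel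
      have hddc : d (f i) (d (f i) (c i ψ)) = 0 := by
        rw [hself, map_sub, hself, hdd0]; simp
      rw [e]
      refine K.add_mem (ih _ ?_ ?_) (hK _ _ (ih _ ?_ ?_))
      · intro x hx
        rw [hdd, hB x hx, h₁ x hx]; simp
      · intro j hj
        by_cases hji : j = i
        · rw [hji, hddc]
        · rw [hdd, hne j i hji, h₂ j (by simp [hj, hji])]; simp
      · intro x hx
        rw [hdd, h₁ x hx]; simp
      · intro j hj
        by_cases hji : j = i
        · rw [hji, hdd0]
        · rw [hdd, h₂ j (by simp [hj, hji])]; simp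
  exact key Finset.univ ψ hψ (by simp)

/-! ### The Clifford algebra of a fermionic representation -/

namespace FermionRep

variable {n : ℕ} {H : Type*} [NormedAddCommGroup H] [InnerProductSpace ℂ H]
  [FiniteDimensional ℂ H] (F : FermionRep n H)

/-- The smeared annihilation operator `∑ i, f i • a i`, without the conjugation of `f` in
`annih`, so that it is linear in `f`. -/
noncomputable def lower : (Fin n → ℂ) →ₗ[ℂ] Module.End ℂ H :=
  Fintype.linearCombination ℂ F.a

/-- The smeared creation operator, as a linear map. -/
noncomputable def raise : (Fin n → ℂ) →ₗ[ℂ] Module.End ℂ H :=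
  Fintype.linearCombination ℂ F.aDag

/-- The Clifford generator `∑ i, f i • a i + ∑ i, g i • a†_i` of the pair `(f, g)`. -/
noncomputable def gamma : ((Fin n → ℂ) × (Fin n → ℂ)) →ₗ[ℂ] Module.End ℂ H :=
  F.lower.coprod F.raise

lemma create_eq (g : Fin n → ℂ) : F.create g = F.raise g := rfl

lemma annih_eq (f : Fin n → ℂ) : F.annih f = F.lower (star f) := rfl

lemma lower_apply (f : Fin n → ℂ) : F.lower f = ∑ i, f i • F.a i := rfl

lemma raise_apply (f : Fin n → ℂ) : F.raise f = ∑ i, f i • F.aDag i := rfl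

lemma gamma_apply (x : (Fin n → ℂ) × (Fin n → ℂ)) :
    F.gamma x = F.lower x.1 + F.raise x.2 := rfl

@[simp] lemma lower_single (i : Fin n) : F.lower (Pi.single i 1) = F.a i := by
  simp [lower]

@[simp] lemma raise_single (i : Fin n) : F.raise (Pi.single i 1) = F.aDag i := by
  simp [raise]

lemma adjoint_aDag (i : Fin n) : LinearMap.adjoint (F.aDag i) = F.a i :=
  LinearMap.adjoint_adjoint _

lemma a_mul_a (i j : Fin n) : F.a i * F.a j + F.a j * F.a i = 0 := by
  have h := congrArg LinearMap.adjoint (F.anticomm_adjoint_adjoint j i)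
  simpa [Module.End.mul_eq_comp, LinearMap.adjoint_comp] using h

lemma lower_mul_lower (f g : Fin n → ℂ) :
    F.lower f * F.lower g + F.lower g * F.lower f = 0 := by
  simp only [lower_apply, Finset.sum_mul_sum]
  rw [Finset.sum_comm (s := Finset.univ) (t := Finset.univ)
    (f := fun i j => (g i • F.a i) * (f j • F.a j)), ← Finset.sum_add_distrib]
  refine Finset.sum_eq_zero fun i _ => ?_
  rw [← Finset.sum_add_distrib]
  refine Finset.sum_eq_zero fun j _ => ?_
  rw [smul_mul_smul_comm, smul_mul_smul_comm, mul_comm (g j), ← smul_add, a_mul_a, smul_zero]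

lemma raise_mul_raise (f g : Fin n → ℂ) :
    F.raise f * F.raise g + F.raise g * F.raise f = 0 := by
  simp only [raise_apply, Finset.sum_mul_sum]
  rw [Finset.sum_comm (s := Finset.univ) (t := Finset.univ)
    (f := fun i j => (g i • F.aDag i) * (f j • F.aDag j)), ← Finset.sum_add_distrib]
  refine Finset.sum_eq_zero fun i _ => ?_
  rw [← Finset.sum_add_distrib]
  refine Finset.sum_eq_zero fun j _ => ?_
  rw [smul_mul_smul_comm, smul_mul_smul_comm, mul_comm (g j), ← smul_add, aDag, aDag,
    F.anticomm_adjoint_adjoint, smul_zero]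

lemma lower_mul_raise (f g : Fin n → ℂ) :
    F.lower f * F.raise g + F.raise g * F.lower f = (f ⬝ᵥ g) • 1 := by
  simp only [lower_apply, raise_apply, Finset.sum_mul_sum]
  rw [Finset.sum_comm (s := Finset.univ) (t := Finset.univ)
    (f := fun i j => (g i • F.aDag i) * (f j • F.a j)), ← Finset.sum_add_distrib,
    dotProduct, Finset.sum_smul]
  refine Finset.sum_congr rfl fun i _ => ?_
  rw [← Finset.sum_add_distrib, Finset.sum_eq_single i]
  · rw [smul_mul_smul_comm, smul_mul_smul_comm, mul_comm (g i), ← smul_add, aDag, add_comm,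
      F.anticomm_adjoint, if_pos rfl]
  · intro j _ hj
    rw [smul_mul_smul_comm, smul_mul_smul_comm, mul_comm (g j), ← smul_add, aDag, add_comm,
      F.anticomm_adjoint, if_neg hj, smul_zero]
  · simp

/-- The bilinear form of the Clifford relations: `lower` and `raise` are isotropic and dual. -/
def pairing (x y : (Fin n → ℂ) × (Fin n → ℂ)) : ℂ := x.1 ⬝ᵥ y.2 + x.2 ⬝ᵥ y.1

lemma gamma_mul_gamma (x y : (Fin n → ℂ) × (Fin n → ℂ)) :
    F.gamma x * F.gamma y = pairing x y • 1 - F.gamma y * F.gamma x := by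
  have h₁ := F.lower_mul_lower x.1 y.1
  have h₂ := F.raise_mul_raise x.2 y.2
  have h₃ := F.lower_mul_raise x.1 y.2
  have h₄ := F.lower_mul_raise y.1 x.2
  rw [dotProduct_comm] at h₄
  have e : F.gamma x * F.gamma y + F.gamma y * F.gamma x =
      (F.lower x.1 * F.lower y.1 + F.lower y.1 * F.lower x.1) +
      (F.raise x.2 * F.raise y.2 + F.raise y.2 * F.raise x.2) +
      ((F.lower x.1 * F.raise y.2 + F.raise y.2 * F.lower x.1) +
      (F.lower y.1 * F.raise x.2 + F.raise x.2 * F.lower y.1)) := by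
    rw [gamma_apply, gamma_apply]
    noncomm_ring
  rw [eq_sub_iff_add_eq, e, h₁, h₂, h₃, h₄, pairing, add_smul, zero_add, zero_add]

lemma lower_vac (f : Fin n → ℂ) : F.lower f F.vac = 0 := by
  simp [lower_apply, F.a_vac]

/-- The vacuum is cyclic for the creation operators. -/
lemma eq_top_of_vac_mem {K : Submodule ℂ H} (h₀ : F.vac ∈ K)
    (h : ∀ i, ∀ ψ ∈ K, F.aDag i ψ ∈ K) : K = ⊤ := by
  rw [eq_top_iff]
  intro ψ _
  refine mem_of_forall_annihilated (X := Fin n) (d := F.a) (c := F.aDag) (f := id) (B := ∅)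
    ?_ (by simp) ?_ ?_ h ?_ ψ (by simp)
  · intro i j φ
    exact eq_neg_of_add_eq_zero_left (LinearMap.congr_fun (F.a_mul_a i j) φ)
  · intro i φ
    have h := LinearMap.congr_fun (F.anticomm_adjoint i i) φ
    simp only [if_true] at h
    rw [eq_sub_iff_add_eq']
    exact h
  · intro i j hij φ
    have h := LinearMap.congr_fun (F.anticomm_adjoint j i) φ
    simp only [if_neg hij.symm] at h
    exact eq_neg_of_add_eq_zero_right h
  · intro φ _ hφ
    obtain ⟨c, rfl⟩ := F.vac_unique φ hφ
    exact K.smul_mem _ h₀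

/-! ### Parity -/

lemma numberSign_anticomm (i : Fin n) :
    (1 - 2 * (F.aDag i * F.a i)) * F.a i = -(F.a i * (1 - 2 * (F.aDag i * F.a i))) ∧
    (1 - 2 * (F.aDag i * F.a i)) * F.aDag i =
      -(F.aDag i * (1 - 2 * (F.aDag i * F.a i))) := by
  have h₀ : F.a i * F.a i = 0 := by
    have h := F.a_mul_a i i
    rw [← two_smul ℂ] at h
    simpa using h
  have h₁ : F.aDag i * F.aDag i = 0 := by
    have h := F.anticomm_adjoint_adjoint i i
    rw [← two_smul ℂ] at h
    simpa [aDag] using h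
  have h₂ : F.a i * F.aDag i = 1 - F.aDag i * F.a i := by
    have h := F.anticomm_adjoint i i
    rw [if_pos rfl] at h
    exact eq_sub_of_add_eq' h
  constructor
  · rw [sub_mul, mul_sub, mul_assoc, mul_assoc, h₀]
    have : F.a i * (2 * (F.aDag i * F.a i)) = 2 * ((F.a i * F.aDag i) * F.a i) := by
      noncomm_ring
    rw [this, h₂, sub_mul, mul_assoc, h₀]
    noncomm_ring
  · rw [sub_mul, mul_sub, mul_assoc, mul_assoc, h₂]
    have : F.aDag i * (2 * (F.aDag i * F.a i)) = 2 * ((F.aDag i * F.aDag i) * F.a i) := by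
      noncomm_ring
    rw [this, h₁, mul_sub, ← mul_assoc (F.aDag i), h₁]
    noncomm_ring

lemma numberSign_commute {i : Fin n} {b : Module.End ℂ H}
    (h₁ : F.a i * b = -(b * F.a i)) (h₂ : F.aDag i * b = -(b * F.aDag i)) :
    (1 - 2 * (F.aDag i * F.a i)) * b = b * (1 - 2 * (F.aDag i * F.a i)) := by
  have : F.aDag i * F.a i * b = b * (F.aDag i * F.a i) := by
    rw [mul_assoc, h₁, mul_neg, ← mul_assoc, h₂, neg_mul, neg_neg, mul_assoc]
  rw [sub_mul, mul_assoc, this]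
  noncomm_ring

/-- The fermion parity `∏ i, (1 - 2 a†_i a_i)`, as an ordered product over `Fin n`; it anticommutes
with every generator, fixes the vacuum and squares to `1`. -/
noncomputable def parity : Module.End ℂ H :=
  ((List.finRange n).map fun i => 1 - 2 * (F.aDag i * F.a i)).prod

lemma prod_numberSign_mul {i : Fin n} {b : Module.End ℂ H}
    (hi : (1 - 2 * (F.aDag i * F.a i)) * b = -(b * (1 - 2 * (F.aDag i * F.a i))))
    (hne : ∀ j ≠ i, (1 - 2 * (F.aDag j * F.a j)) * b = b * (1 - 2 * (F.aDag j * F.a j)))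
    (l : List (Fin n)) (hl : l.Nodup) :
    (l.map fun j => 1 - 2 * (F.aDag j * F.a j)).prod * b =
      (if i ∈ l then -1 else 1) * (b * (l.map fun j => 1 - 2 * (F.aDag j * F.a j)).prod) := by
  induction l with
  | nil => simp
  | cons j l ih =>
    rw [List.nodup_cons] at hl
    rw [List.map_cons, List.prod_cons, mul_assoc, ih hl.2]
    by_cases hij : j = i
    · subst hij
      rw [if_neg hl.1, if_pos (by simp), one_mul, ← mul_assoc, hi]
      noncomm_ring
    · have : (i ∈ j :: l) ↔ i ∈ l := by simp [Ne.symm hij]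
      simp only [this]
      split_ifs
      · rw [neg_one_mul, neg_one_mul, mul_neg, ← mul_assoc, hne j hij, mul_assoc]
      · rw [one_mul, one_mul, ← mul_assoc, hne j hij, mul_assoc]

lemma parity_mul_a (i : Fin n) : F.parity * F.a i = -(F.a i * F.parity) := by
  have h := F.prod_numberSign_mul (F.numberSign_anticomm i).1 (fun j hj =>
    F.numberSign_commute (eq_neg_of_add_eq_zero_left (F.a_mul_a j i))
      (eq_neg_of_add_eq_zero_left ((F.anticomm_adjoint j i).trans (if_neg hj))))
    (List.finRange n) (List.nodup_finRange n)
  rwa [if_pos (List.mem_finRange i), neg_one_mul] at h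

lemma parity_mul_aDag (i : Fin n) : F.parity * F.aDag i = -(F.aDag i * F.parity) := by
  have h := F.prod_numberSign_mul (F.numberSign_anticomm i).2 (fun j hj =>
    F.numberSign_commute
      (eq_neg_of_add_eq_zero_right ((F.anticomm_adjoint i j).trans (if_neg hj.symm)))
      (eq_neg_of_add_eq_zero_left (F.anticomm_adjoint_adjoint j i)))
    (List.finRange n) (List.nodup_finRange n)
  rwa [if_pos (List.mem_finRange i), neg_one_mul] at h

lemma parity_vac : F.parity F.vac = F.vac := by
  unfold parity
  induction List.finRange n with
  | nil => rfl
  | cons i l ih =>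
    rw [List.map_cons, List.prod_cons, Module.End.mul_apply, ih, LinearMap.sub_apply,
      Module.End.mul_apply, Module.End.mul_apply, F.a_vac]
    simp

lemma parity_mul_gamma (x : (Fin n → ℂ) × (Fin n → ℂ)) :
    F.parity * F.gamma x = -(F.gamma x * F.parity) := by
  simp only [gamma_apply, lower_apply, raise_apply, mul_add, add_mul, Finset.mul_sum,
    Finset.sum_mul, mul_smul_comm, smul_mul_assoc, parity_mul_a, parity_mul_aDag, neg_add,
    smul_neg, Finset.sum_neg_distrib]

lemma parity_mul_parity : F.parity * F.parity = 1 := by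
  have h : LinearMap.ker (F.parity * F.parity - 1) = ⊤ := by
    refine F.eq_top_of_vac_mem ?_ fun i ψ hψ => ?_
    · simp [parity_vac]
    · have e : F.parity * F.parity * F.aDag i = F.aDag i * (F.parity * F.parity) := by
        rw [mul_assoc, parity_mul_aDag, mul_neg, ← mul_assoc, parity_mul_aDag, neg_mul, neg_neg,
          mul_assoc]
      have e' := LinearMap.congr_fun e ψ
      simp only [LinearMap.mem_ker, LinearMap.sub_apply, Module.End.one_apply, sub_eq_zero,
        Module.End.mul_apply] at hψ e' ⊢
      rw [e', hψ]
  exact sub_eq_zero.mp (LinearMap.ker_eq_top.mp h)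

/-! ### Operators as a Fock space -/

/-- The graded commutator `X ↦ γ X - (P X P) γ` with the Clifford generator `γ` of `x`. -/
noncomputable def gradedComm (x : (Fin n → ℂ) × (Fin n → ℂ)) :
    Module.End ℂ (Module.End ℂ H) where
  toFun X := F.gamma x * X - F.parity * X * F.parity * F.gamma x
  map_add' X Y := by noncomm_ring
  map_smul' c X := by simp [smul_sub]

lemma gradedComm_apply (x : (Fin n → ℂ) × (Fin n → ℂ)) (X : Module.End ℂ H) :
    F.gradedComm x X = F.gamma x * X - F.parity * X * F.parity * F.gamma x := rfl

/-- The twisted right multiplication `X ↦ (P X P) γ` by the Clifford generator `γ` of `x`. -/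
noncomputable def twistedRight (x : (Fin n → ℂ) × (Fin n → ℂ)) :
    Module.End ℂ (Module.End ℂ H) where
  toFun X := F.parity * X * F.parity * F.gamma x
  map_add' X Y := by noncomm_ring
  map_smul' c X := by simp

lemma twistedRight_apply (x : (Fin n → ℂ) × (Fin n → ℂ)) (X : Module.End ℂ H) :
    F.twistedRight x X = F.parity * X * F.parity * F.gamma x := rfl

lemma parity_conj_gamma_mul (x : (Fin n → ℂ) × (Fin n → ℂ)) (X : Module.End ℂ H) :
    F.parity * (F.gamma x * X) * F.parity = -(F.gamma x * (F.parity * X * F.parity)) := by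
  rw [← mul_assoc, parity_mul_gamma]
  noncomm_ring

lemma parity_conj_mul_gamma (x : (Fin n → ℂ) × (Fin n → ℂ)) (X : Module.End ℂ H) :
    F.parity * (X * F.gamma x) * F.parity = -(F.parity * X * F.parity * F.gamma x) := by
  have h := F.parity_mul_gamma x
  rw [mul_assoc (F.parity * X), h]
  noncomm_ring

lemma parity_conj_parity_conj (X : Module.End ℂ H) :
    F.parity * (F.parity * X * F.parity) * F.parity = X := by
  have h : F.parity * (F.parity * X * F.parity) * F.parity =
    (F.parity * F.parity) * X * (F.parity * F.parity) := by noncomm_ring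
  rw [h, parity_mul_parity, one_mul, mul_one]

lemma gradedComm_gradedComm (x y : (Fin n → ℂ) × (Fin n → ℂ)) (X : Module.End ℂ H) :
    F.gradedComm x (F.gradedComm y X) = -F.gradedComm y (F.gradedComm x X) := by
  simp only [gradedComm_apply, mul_sub, sub_mul, parity_conj_gamma_mul, parity_conj_mul_gamma,
    parity_conj_parity_conj]
  have h := F.gamma_mul_gamma x y
  have h₁ : F.gamma x * (F.gamma y * X) = pairing x y • X - F.gamma y * (F.gamma x * X) := by
    rw [← mul_assoc, h, sub_mul, smul_mul_assoc, one_mul, mul_assoc]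
  have h₂ : X * (F.gamma x * F.gamma y) = pairing x y • X - X * (F.gamma y * F.gamma x) := by
    rw [h, mul_sub, mul_smul_comm, mul_one]
  simp only [neg_mul, mul_assoc, h₁, h₂]
  abel

/-- `gradedComm x` and left multiplication by the generator of `y` satisfy canonical
anticommutation relations on the space of operators. -/
lemma gradedComm_gamma_mul (x y : (Fin n → ℂ) × (Fin n → ℂ)) (X : Module.End ℂ H) :
    F.gradedComm x (F.gamma y * X) = pairing x y • X - F.gamma y * F.gradedComm x X := by
  simp only [gradedComm_apply, parity_conj_gamma_mul]
  rw [← mul_assoc (F.gamma x), F.gamma_mul_gamma x y]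
  simp only [sub_mul, mul_sub, smul_mul_assoc, one_mul, neg_mul, mul_assoc]
  abel

/-- The counterpart of `gradedComm_gamma_mul` for the twisted right multiplications; the conjugation
by the parity is what makes this an anticommutator. -/
lemma gradedComm_twistedRight (x y : (Fin n → ℂ) × (Fin n → ℂ)) (X : Module.End ℂ H) :
    F.gradedComm x (F.twistedRight y X) =
      pairing x y • X - F.twistedRight y (F.gradedComm x X) := by
  simp only [gradedComm_apply, twistedRight_apply, mul_sub, sub_mul, parity_conj_gamma_mul,
    parity_conj_mul_gamma, parity_conj_parity_conj]
  have h : X * (F.gamma x * F.gamma y) = pairing x y • X - X * (F.gamma y * F.gamma x) := by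
    rw [F.gamma_mul_gamma x y, mul_sub, mul_smul_comm, mul_one]
  simp only [neg_mul, mul_assoc, h]
  abel

/-- Irreducibility: an operator that graded-commutes with all Clifford generators is a scalar. -/
lemma mem_span_one_of_gradedComm_eq_zero {X : Module.End ℂ H}
    (hX : ∀ x, F.gradedComm x X = 0) : X ∈ Submodule.span ℂ {(1 : Module.End ℂ H)} := by
  have h₁ : ∀ x, F.gamma x * X = F.parity * X * F.parity * F.gamma x :=
    fun x => sub_eq_zero.mp (hX x)
  have h₂ : ∀ x, F.gamma x * (F.parity * X * F.parity) = X * F.gamma x := fun x => by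
    have h := congrArg (fun Y => F.parity * Y * F.parity) (h₁ x)
    simp only [parity_conj_gamma_mul, parity_conj_mul_gamma, parity_conj_parity_conj] at h
    simpa using h
  obtain ⟨c, hc⟩ : ∃ c : ℂ, X F.vac = c • F.vac := by
    refine F.vac_unique _ fun i => ?_
    have h := LinearMap.congr_fun (h₁ (Pi.single i 1, 0)) F.vac
    simpa [gamma_apply, F.a_vac] using h
  have hK : LinearMap.ker (X - c • (1 : Module.End ℂ H)) ⊓
      LinearMap.ker (F.parity * X * F.parity - c • (1 : Module.End ℂ H)) = ⊤ := by
    refine F.eq_top_of_vac_mem ?_ fun i ψ hψ => ?_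
    · simp [hc, parity_vac]
    · have e₁ := LinearMap.congr_fun (h₁ (0, Pi.single i 1)) ψ
      have e₂ := LinearMap.congr_fun (h₂ (0, Pi.single i 1)) ψ
      simp only [gamma_apply, map_zero, zero_add, raise_single, Module.End.mul_apply] at e₁ e₂
      simp only [Submodule.mem_inf, LinearMap.mem_ker, LinearMap.sub_apply, LinearMap.smul_apply,
        Module.End.one_apply, Module.End.mul_apply, sub_eq_zero] at hψ ⊢
      rw [← e₁, ← e₂, hψ.1, hψ.2]
      simp
  have : X - c • (1 : Module.End ℂ H) = 0 := LinearMap.ker_eq_top.mp (eq_top_iff.mpr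
    (hK ▸ inf_le_left))
  rw [sub_eq_zero.mp this]
  exact Submodule.smul_mem _ _ (Submodule.mem_span_singleton_self _)

end FermionRep

/-! ### Spans of normally ordered monomials -/

section NormalSpan

variable {R : Type*} [Ring R] [Algebra ℂ R] {m : ℕ}

/-- The span of the normally ordered monomials in the `x i` (to the left) and the `y i`
(to the right) with indices in `T`. -/
def normalSpan (T : Finset (Fin m)) (x y : Fin m → R) : Submodule ℂ R :=
  Submodule.span ℂ {P : R | ∃ S₁ S₂ : Finset (Fin m), S₁ ⊆ T ∧ S₂ ⊆ T ∧
    P = prodIncr S₁ x * prodDecr S₂ y}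

/-- The span of the normally ordered monomials of even degree. -/
def evenNormalSpan (T : Finset (Fin m)) (x y : Fin m → R) : Submodule ℂ R :=
  Submodule.span ℂ {P : R | ∃ S₁ S₂ : Finset (Fin m), S₁ ⊆ T ∧ S₂ ⊆ T ∧
    Even (S₁.card + S₂.card) ∧ P = prodIncr S₁ x * prodDecr S₂ y}

lemma one_mem_normalSpan (T : Finset (Fin m)) (x y : Fin m → R) : 1 ∈ normalSpan T x y :=
  Submodule.subset_span ⟨∅, ∅, by simp, by simp, by simp [prodIncr, prodDecr]⟩

lemma mul_mem_normalSpan {T : Finset (Fin m)} {x y : Fin m → R}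
    (hx : ∀ i j, x i * x j = -(x j * x i)) (hxx : ∀ i, x i * x i = 0) {i : Fin m} (hi : i ∈ T)
    {O : R} (hO : O ∈ normalSpan T x y) : x i * O ∈ normalSpan T x y := by
  suffices h : normalSpan T x y ≤ (normalSpan T x y).comap (LinearMap.mulLeft ℂ (x i)) from h hO
  refine Submodule.span_le.mpr ?_
  rintro _ ⟨S₁, S₂, h₁, h₂, rfl⟩
  have hmem : prodIncr (insert i S₁) x * prodDecr S₂ y ∈ normalSpan T x y :=
    Submodule.subset_span ⟨_, _, Finset.insert_subset hi h₁, h₂, rfl⟩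
  simp only [SetLike.mem_coe, Submodule.mem_comap, LinearMap.mulLeft_apply, ← mul_assoc]
  rcases mul_prodIncr_eq hx hxx i S₁ with h | h | h <;> rw [h]
  · simp
  · exact hmem
  · rw [neg_mul]; exact Submodule.neg_mem _ hmem

lemma mem_normalSpan_mul {T : Finset (Fin m)} {x y : Fin m → R}
    (hy : ∀ i j, y i * y j = -(y j * y i)) (hyy : ∀ i, y i * y i = 0) {i : Fin m} (hi : i ∈ T)
    {O : R} (hO : O ∈ normalSpan T x y) : O * y i ∈ normalSpan T x y := by
  suffices h : normalSpan T x y ≤ (normalSpan T x y).comap (LinearMap.mulRight ℂ (y i)) from h hO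
  refine Submodule.span_le.mpr ?_
  rintro _ ⟨S₁, S₂, h₁, h₂, rfl⟩
  have hmem : prodIncr S₁ x * prodDecr (insert i S₂) y ∈ normalSpan T x y :=
    Submodule.subset_span ⟨_, _, h₁, Finset.insert_subset hi h₂, rfl⟩
  simp only [SetLike.mem_coe, Submodule.mem_comap, LinearMap.mulRight_apply, mul_assoc]
  rcases prodDecr_mul_eq hy hyy i S₂ with h | h | h <;> rw [h]
  · simp
  · exact hmem
  · rw [mul_neg]; exact Submodule.neg_mem _ hmem

lemma parity_conj_mem_normalSpan {T : Finset (Fin m)} {x y : Fin m → R} {P : R} (hP : P * P = 1)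
    (hx : ∀ i, P * x i = -(x i * P)) (hy : ∀ i, P * y i = -(y i * P)) {O : R}
    (hO : O ∈ normalSpan T x y) : P * O * P ∈ normalSpan T x y := by
  suffices h : normalSpan T x y ≤ (normalSpan T x y).comap
      (LinearMap.mulRight ℂ P ∘ₗ LinearMap.mulLeft ℂ P) from h hO
  refine Submodule.span_le.mpr ?_
  rintro _ ⟨S₁, S₂, h₁, h₂, rfl⟩
  have hmem : prodIncr S₁ x * prodDecr S₂ y ∈ normalSpan T x y :=
    Submodule.subset_span ⟨_, _, h₁, h₂, rfl⟩
  simp only [SetLike.mem_coe, Submodule.mem_comap, LinearMap.comp_apply, LinearMap.mulRight_apply,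
    LinearMap.mulLeft_apply, parity_conj_monomial hP hx hy]
  rcases neg_one_pow_eq_or R (S₁.card + S₂.card) with h | h <;> rw [h]
  · simpa using hmem
  · simpa using hmem

/-- Averaging over conjugation by the parity removes the monomials of odd degree. -/
lemma mem_evenNormalSpan_of_commute {T : Finset (Fin m)} {x y : Fin m → R} {P : R}
    (hP : P * P = 1) (hx : ∀ i, P * x i = -(x i * P)) (hy : ∀ i, P * y i = -(y i * P)) {O : R}
    (hO : O ∈ normalSpan T x y) (hPO : Commute P O) : O ∈ evenNormalSpan T x y := by
  have h : normalSpan T x y ≤ (evenNormalSpan T x y).comap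
      (LinearMap.id + LinearMap.mulRight ℂ P ∘ₗ LinearMap.mulLeft ℂ P) := by
    refine Submodule.span_le.mpr ?_
    rintro _ ⟨S₁, S₂, h₁, h₂, rfl⟩
    simp only [SetLike.mem_coe, Submodule.mem_comap, LinearMap.add_apply, LinearMap.id_apply,
      LinearMap.comp_apply, LinearMap.mulRight_apply,
      LinearMap.mulLeft_apply, parity_conj_monomial hP hx hy]
    rcases Nat.even_or_odd (S₁.card + S₂.card) with h | h
    · have hmem : prodIncr S₁ x * prodDecr S₂ y ∈ evenNormalSpan T x y :=
        Submodule.subset_span ⟨_, _, h₁, h₂, h, rfl⟩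
      rw [h.neg_one_pow, one_mul]
      exact Submodule.add_mem _ hmem hmem
    · rw [h.neg_one_pow, neg_one_mul, add_neg_cancel]
      exact Submodule.zero_mem _
  have h2 := h hO
  simp only [Submodule.mem_comap, LinearMap.add_apply, LinearMap.id_apply,
      LinearMap.comp_apply, LinearMap.mulRight_apply, LinearMap.mulLeft_apply] at h2
  rw [hPO.eq, mul_assoc, hP, mul_one, ← two_smul ℂ] at h2
  exact (Submodule.smul_mem_iff _ two_ne_zero).mp h2

/-- An element of the span of the even monomials, written with coefficients. -/
lemma exists_coeff_of_mem_evenNormalSpan {x y : Fin m → R} {O : R}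
    (hO : O ∈ evenNormalSpan Finset.univ x y) :
    ∃ c : Finset (Fin m) → Finset (Fin m) → ℂ,
      (∀ S₁ S₂, Odd (S₁.card + S₂.card) → c S₁ S₂ = 0) ∧
      O = ∑ S₁, ∑ S₂, c S₁ S₂ • (prodIncr S₁ x * prodDecr S₂ y) := by
  induction hO using Submodule.span_induction with
  | mem O h =>
    obtain ⟨T₁, T₂, -, -, hT, rfl⟩ := h
    refine ⟨fun S₁ S₂ => if S₁ = T₁ ∧ S₂ = T₂ then 1 else 0, fun S₁ S₂ h => ?_, ?_⟩
    · refine if_neg ?_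
      rintro ⟨rfl, rfl⟩
      exact Nat.not_even_iff_odd.mpr h hT
    · rw [Finset.sum_eq_single T₁, Finset.sum_eq_single T₂]
      · simp
      · intro S₂ _ h; simp [h]
      · simp
      · intro S₁ _ h; simp [h]
      · simp
  | zero => exact ⟨0, by simp, by simp⟩
  | add O O' _ _ h h' =>
    obtain ⟨c, hc, e⟩ := h
    obtain ⟨c', hc', e'⟩ := h'
    refine ⟨c + c', fun S₁ S₂ h => by simp [hc _ _ h, hc' _ _ h], ?_⟩
    simp only [Pi.add_apply, add_smul, Finset.sum_add_distrib, ← e, ← e']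
  | smul r O _ h =>
    obtain ⟨c, hc, e⟩ := h
    refine ⟨r • c, fun S₁ S₂ h => by simp [hc _ _ h], ?_⟩
    simp only [Pi.smul_apply, smul_assoc, ← Finset.smul_sum, ← e]

lemma commute_of_mem_evenNormalSpan {T : Finset (Fin m)} {x y : Fin m → R} {z : R}
    (hx : ∀ i ∈ T, z * x i = -(x i * z)) (hy : ∀ i ∈ T, z * y i = -(y i * z)) {O : R}
    (hO : O ∈ evenNormalSpan T x y) : Commute z O := by
  induction hO using Submodule.span_induction with
  | mem O h =>
    obtain ⟨S₁, S₂, h₁, h₂, h, rfl⟩ := h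
    have e := mul_monomial_of_anticomm (fun i hi => hx i (h₁ hi)) (fun i hi => hy i (h₂ hi))
    rwa [h.neg_one_pow, one_mul] at e
  | zero => exact Commute.zero_right _
  | add O O' _ _ h h' => exact h.add_right h'
  | smul r O _ h => exact h.smul_right r

end NormalSpan

namespace FermionRep

variable {n : ℕ} {H : Type*} [NormedAddCommGroup H] [InnerProductSpace ℂ H]
  [FiniteDimensional ℂ H] (F : FermionRep n H)

lemma raise_anticomm (f g : Fin n → ℂ) : F.raise f * F.raise g = -(F.raise g * F.raise f) :=
  eq_neg_of_add_eq_zero_left (F.raise_mul_raise f g)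

lemma lower_anticomm (f g : Fin n → ℂ) : F.lower f * F.lower g = -(F.lower g * F.lower f) :=
  eq_neg_of_add_eq_zero_left (F.lower_mul_lower f g)

lemma raise_mul_self (f : Fin n → ℂ) : F.raise f * F.raise f = 0 := by
  have h := F.raise_mul_raise f f
  rw [← two_smul ℂ] at h
  simpa using h

lemma lower_mul_self (f : Fin n → ℂ) : F.lower f * F.lower f = 0 := by
  have h := F.lower_mul_lower f f
  rw [← two_smul ℂ] at h
  simpa using h

lemma parity_mul_lower (f : Fin n → ℂ) : F.parity * F.lower f = -(F.lower f * F.parity) := by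
  simpa [gamma_apply] using F.parity_mul_gamma (f, 0)

lemma parity_mul_raise (f : Fin n → ℂ) : F.parity * F.raise f = -(F.raise f * F.parity) := by
  simpa [gamma_apply] using F.parity_mul_gamma (0, f)

lemma lower_mul_raise_anticomm {f g : Fin n → ℂ} (h : f ⬝ᵥ g = 0) :
    F.lower f * F.raise g = -(F.raise g * F.lower f) := by
  have e := F.lower_mul_raise f g
  rw [h, zero_smul] at e
  exact eq_neg_of_add_eq_zero_left e

lemma raise_mul_lower_anticomm {f g : Fin n → ℂ} (h : f ⬝ᵥ g = 0) :
    F.raise f * F.lower g = -(F.lower g * F.raise f) := by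
  have e := F.lower_mul_raise g f
  rw [dotProduct_comm, h, zero_smul] at e
  exact eq_neg_of_add_eq_zero_right e

/-- The generators orthogonal to a family `y` and a family `z` dual to `y` together span all
generators, so it is enough to test graded commutation on these. -/
lemma gradedComm_eq_zero_of_dual {ι : Type*} [Fintype ι] [DecidableEq ι]
    {y z : ι → (Fin n → ℂ) × (Fin n → ℂ)}
    (hzy : ∀ i j, pairing (z i) (y j) = if i = j then 1 else 0) {X : Module.End ℂ H}
    (hB : ∀ x, (∀ i, pairing x (y i) = 0) → F.gradedComm x X = 0)
    (hz : ∀ i, F.gradedComm (z i) X = 0) (x : (Fin n → ℂ) × (Fin n → ℂ)) :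
    F.gradedComm x X = 0 := by
  let L : ((Fin n → ℂ) × (Fin n → ℂ)) →ₗ[ℂ] Module.End ℂ H :=
    (LinearMap.mulRight ℂ X - LinearMap.mulLeft ℂ (F.parity * X * F.parity)) ∘ₗ F.gamma
  have hL : ∀ x, F.gradedComm x X = L x := fun x => rfl
  have hlin : ∀ w : (Fin n → ℂ) × (Fin n → ℂ), IsLinearMap ℂ fun x => pairing x w := fun w =>
    ⟨fun a b => by simp [pairing, add_dotProduct]; ring,
      fun a b => by simp [pairing, smul_dotProduct]; ring⟩
  have h := hB (x - ∑ i, pairing x (y i) • z i) fun j => by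
    have e := map_sub ((hlin (y j)).mk') x (∑ i, pairing x (y i) • z i)
    simp only [map_sum, map_smul, IsLinearMap.mk'_apply, hzy] at e
    rw [e]
    simp
  have hz' : ∀ i, L (z i) = 0 := hz
  rw [hL, map_sub, map_sum] at h
  simp only [map_smul, hz', smul_zero, Finset.sum_const_zero, sub_zero] at h
  exact h

/-- An even operator that commutes with `lower x` for all `x` orthogonal to the `w i`, and with
`raise x` for all `x` orthogonal to the `u i`, is a combination of even normally ordered monomials
in the `raise (w i)` and `lower (u i)`.  The space of operators on `H` is regarded here as a Fock
space with vacuum `1`, whose annihilators are the graded commutators and whose creators are left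
and twisted right multiplications. -/
theorem mem_evenNormalSpan {m : ℕ} {T : Finset (Fin m)} {w u f g : Fin m → Fin n → ℂ}
    (hfw : ∀ i j, f i ⬝ᵥ w j = if i = j then 1 else 0)
    (hgu : ∀ i j, g i ⬝ᵥ u j = if i = j then 1 else 0)
    {O : Module.End ℂ H} (hP : Commute F.parity O)
    (hl : ∀ x, (∀ i ∈ T, x ⬝ᵥ w i = 0) → Commute O (F.lower x))
    (hr : ∀ x, (∀ i ∈ T, x ⬝ᵥ u i = 0) → Commute O (F.raise x)) :
    O ∈ evenNormalSpan T (fun i => F.raise (w i)) (fun i => F.lower (u i)) := by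
  refine mem_evenNormalSpan_of_commute F.parity_mul_parity (fun i => F.parity_mul_raise _)
    (fun i => F.parity_mul_lower _) ?_ hP
  set K := normalSpan T (fun i => F.raise (w i)) (fun i => F.lower (u i))
  let y : T ⊕ T → (Fin n → ℂ) × (Fin n → ℂ) := Sum.elim (fun i => (0, w i)) (fun i => (u i, 0))
  let z : T ⊕ T → (Fin n → ℂ) × (Fin n → ℂ) := Sum.elim (fun i => (f i, 0)) (fun i => (0, g i))
  let c : T ⊕ T → Module.End ℂ (Module.End ℂ H) :=
    Sum.elim (fun i => LinearMap.mulLeft ℂ (F.gamma (0, w i))) (fun i => F.twistedRight (u i, 0))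
  have hdc : ∀ x i X, F.gradedComm x (c i X) =
      pairing x (y i) • X - c i (F.gradedComm x X) := by
    rintro x (i | i) X
    · exact F.gradedComm_gamma_mul x _ X
    · exact F.gradedComm_twistedRight x _ X
  have hzy : ∀ i j, pairing (z i) (y j) = if i = j then 1 else 0 := by
    rintro (i | i) (j | j) <;> simp [pairing, y, z, hfw, hgu]
  refine mem_of_forall_annihilated (d := F.gradedComm) (c := c) (f := z)
    (B := {x | ∀ i, pairing x (y i) = 0}) F.gradedComm_gradedComm ?_ ?_ ?_ ?_ ?_ O ?_
  · intro x hx i X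
    rw [hdc, hx i]; simp
  · intro i X
    rw [hdc, hzy]; simp
  · intro i j hij X
    rw [hdc, hzy]; simp [hij]
  · rintro (i | i) X hX
    · have := mul_mem_normalSpan (fun i j => F.raise_anticomm (w i) (w j))
        (fun i => F.raise_mul_self _) i.2 hX
      simpa [c, gamma_apply] using this
    · have := mem_normalSpan_mul (fun i j => F.lower_anticomm (u i) (u j))
        (fun i => F.lower_mul_self _) i.2
        (parity_conj_mem_normalSpan F.parity_mul_parity (fun i => F.parity_mul_raise _)
          (fun i => F.parity_mul_lower _) hX)
      simpa [c, gamma_apply, twistedRight_apply] using this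
  · intro X hB hz
    have h := F.mem_span_one_of_gradedComm_eq_zero (F.gradedComm_eq_zero_of_dual hzy hB hz)
    refine Submodule.span_le.mpr ?_ h
    simpa using one_mem_normalSpan T _ _
  · intro x hx
    have h₁ : Commute O (F.lower x.1) := hl _ fun i hi => by
      simpa [pairing, y] using hx (.inl ⟨i, hi⟩)
    have h₂ : Commute O (F.raise x.2) := hr _ fun i hi => by
      simpa [pairing, y] using hx (.inr ⟨i, hi⟩)
    have h₃ : F.parity * O * F.parity = O := by
      rw [hP.eq, mul_assoc, parity_mul_parity, mul_one]
    rw [gradedComm_apply, h₃, gamma_apply, sub_eq_zero]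
    exact (h₁.add_right h₂).eq.symm

/-! ### Locality as a commutation property -/

/-- Bravyi–Kitaev locality to `A` means commuting with the parity and with the modes outside
`A`. -/
theorem isBKLocal_iff {A : Finset (Fin n)} {O : Module.End ℂ H} :
    F.IsBKLocal A O ↔ Commute F.parity O ∧
      (∀ x : Fin n → ℂ, (∀ i ∈ A, x i = 0) → Commute O (F.lower x)) ∧
      (∀ x : Fin n → ℂ, (∀ i ∈ A, x i = 0) → Commute O (F.raise x)) := by
  constructor
  · intro h
    change O ∈ evenNormalSpan A F.aDag F.a at h
    refine ⟨commute_of_mem_evenNormalSpan (fun i _ => F.parity_mul_aDag i)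
      (fun i _ => F.parity_mul_a i) h, fun x hx => ?_, fun x hx => ?_⟩
    · refine (commute_of_mem_evenNormalSpan (fun i hi => ?_) (fun i _ => ?_) h).symm
      · rw [← raise_single]
        exact F.lower_mul_raise_anticomm (by simp [hx i hi])
      · rw [← lower_single]
        exact F.lower_anticomm _ _
    · refine (commute_of_mem_evenNormalSpan (fun i _ => ?_) (fun i hi => ?_) h).symm
      · rw [← raise_single]
        exact F.raise_anticomm _ _
      · rw [← lower_single]
        exact F.raise_mul_lower_anticomm (by simp [hx i hi])
  · rintro ⟨hP, hl, hr⟩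
    have h := F.mem_evenNormalSpan (T := A) (w := fun i => Pi.single i 1)
      (u := fun i => Pi.single i 1) (f := fun i => Pi.single i 1) (g := fun i => Pi.single i 1)
      (fun i j => by simp [Pi.single_apply, eq_comm])
      (fun i j => by simp [Pi.single_apply, eq_comm]) hP
      (fun x hx => hl x (by simpa using hx)) (fun x hx => hr x (by simpa using hx))
    simp only [raise_single, lower_single] at h
    exact h

end FermionRep

/-! ### The local kernel -/

section LocalKer

open Matrix

lemma Matrix.IsHermitian.star_mulVec_transpose {n : ℕ} {M : Matrix (Fin n) (Fin n) ℂ}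
    (hM : M.IsHermitian) (x : Fin n → ℂ) : star (M *ᵥ x) = Mᵀ *ᵥ star x := by
  rw [Matrix.star_mulVec, hM.eq, Matrix.mulVec_transpose]

/-- The space `ℂ^A ∩ M⁻¹ ℂ^A`, which is `ker M^{A'A}` viewed inside `ℂ^n`. -/
def localKer {n : ℕ} (M : Matrix (Fin n) (Fin n) ℂ) (A : Finset (Fin n)) :
    Submodule ℂ (Fin n → ℂ) where
  carrier := {x | ∀ i ∉ A, x i = 0 ∧ (M *ᵥ x) i = 0}
  add_mem' {x y} hx hy i hi := by
    simp [mulVec_add, hx i hi, hy i hi]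
  zero_mem' := by simp
  smul_mem' c x hx i hi := by
    simp [mulVec_smul, hx i hi]

/-- A vector is in a subspace as soon as it is orthogonal, for the bilinear dot product, to
everything orthogonal to the subspace. -/
lemma Submodule.mem_of_forall_dotProduct {n : ℕ} {Q : Submodule ℂ (Fin n → ℂ)} {f : Fin n → ℂ}
    (h : ∀ x : Fin n → ℂ, (∀ q ∈ Q, q ⬝ᵥ x = 0) → f ⬝ᵥ x = 0) : f ∈ Q := by
  by_contra hf
  obtain ⟨φ, hφ, hQ⟩ := Submodule.exists_le_ker_of_notMem hf
  have e : ∀ v, v ⬝ᵥ (fun i => φ (Pi.single i 1)) = φ v := fun v => by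
    conv_rhs => rw [pi_eq_sum_univ' v]
    simp [dotProduct]
  refine hφ ?_
  rw [← e]
  exact h _ fun q hq => by rw [e]; exact hQ hq

lemma localKer_mono {n : ℕ} (M : Matrix (Fin n) (Fin n) ℂ) {S A : Finset (Fin n)} (h : S ⊆ A) :
    localKer M S ≤ localKer M A :=
  fun _ hx i hi => hx i fun hiS => hi (h hiS)

lemma extendZero_of_notMem {n : ℕ} {A : Finset (Fin n)} (v : {i : Fin n // i ∈ A} → ℂ) {i : Fin n}
    (hi : i ∉ A) : extendZero A v i = 0 := dif_neg hi

lemma extendZero_of_mem {n : ℕ} {A : Finset (Fin n)} (v : {i : Fin n // i ∈ A} → ℂ) {i : Fin n}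
    (hi : i ∈ A) : extendZero A v i = v ⟨i, hi⟩ := dif_pos hi

lemma mulVec_extendZero {n : ℕ} (M : Matrix (Fin n) (Fin n) ℂ) {A : Finset (Fin n)}
    (v : {i : Fin n // i ∈ A} → ℂ) (i : Fin n) :
    (M *ᵥ extendZero A v) i = ∑ j : {j : Fin n // j ∈ A}, M i j * v j := by
  rw [mulVec, dotProduct, ← Finset.sum_subset (Finset.subset_univ A), ← Finset.sum_coe_sort A]
  · exact Finset.sum_congr rfl fun j _ => by rw [extendZero_of_mem v j.2]
  · intro j _ hj
    rw [extendZero_of_notMem v hj, mul_zero]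

lemma mulVec_extendZero_eq {n : ℕ} {M : Matrix (Fin n) (Fin n) ℂ} {A : Finset (Fin n)}
    {v : {i : Fin n // i ∈ A} → ℂ} (hv : v ∈ offKer M A) :
    M *ᵥ extendZero A v = extendZero A (diagBlock M A *ᵥ v) := by
  ext i
  rw [mulVec_extendZero]
  by_cases hi : i ∈ A
  · rw [extendZero_of_mem _ hi]
    rfl
  · rw [extendZero_of_notMem _ hi]
    exact congrFun (LinearMap.mem_ker.mp hv) ⟨i, hi⟩

/-- Extension by zero identifies `ker M^{A'A}` with `ℂ^A ∩ M⁻¹ ℂ^A`. -/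
def offKerEquiv {n : ℕ} (M : Matrix (Fin n) (Fin n) ℂ) (A : Finset (Fin n)) :
    offKer M A ≃ₗ[ℂ] localKer M A where
  toFun v := ⟨extendZero A v.1, fun i hi => ⟨extendZero_of_notMem _ hi, by
    rw [mulVec_extendZero_eq v.2, extendZero_of_notMem _ hi]⟩⟩
  map_add' v w := by
    ext i
    by_cases hi : i ∈ A <;> simp [extendZero, hi]
  map_smul' c v := by
    ext i
    by_cases hi : i ∈ A <;> simp [extendZero, hi]
  invFun x := ⟨fun i => x.1 i, by
    refine LinearMap.mem_ker.mpr (funext fun i => ?_)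
    have h := (x.2 i i.2).2
    have e : x.1 = extendZero A fun i => x.1 i := by
      ext j
      by_cases hj : j ∈ A
      · rw [extendZero_of_mem _ hj]
      · rw [extendZero_of_notMem _ hj, (x.2 j hj).1]
    rw [e, mulVec_extendZero] at h
    exact h⟩
  left_inv v := by
    ext i
    exact extendZero_of_mem _ i.2
  right_inv x := by
    ext j
    by_cases hj : j ∈ A
    · exact extendZero_of_mem _ hj
    · exact (extendZero_of_notMem _ hj).trans (x.2 j hj).1.symm

lemma finrank_localKer {n : ℕ} (M : Matrix (Fin n) (Fin n) ℂ) (A : Finset (Fin n)) :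
    Module.finrank ℂ (localKer M A) = kerDim M A :=
  (offKerEquiv M A).finrank_eq.symm

/-- A linearly independent family has a dual family for the bilinear dot product. -/
lemma LinearIndependent.exists_dotProduct_dual {n k : ℕ} {w : Fin k → Fin n → ℂ}
    (hw : LinearIndependent ℂ w) :
    ∃ f : Fin k → Fin n → ℂ, ∀ i j, f i ⬝ᵥ w j = if i = j then 1 else 0 := by
  obtain ⟨g, hg⟩ := LinearMap.exists_leftInverse_of_injective (Fintype.linearCombination ℂ w)
    (LinearMap.ker_eq_bot.mpr hw.fintypeLinearCombination_injective)
  refine ⟨fun i l => g (Pi.single l 1) i, fun i j => ?_⟩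
  have h := congrFun (LinearMap.congr_fun hg (Pi.single j 1)) i
  simp only [LinearMap.comp_apply, Fintype.linearCombination_apply_single, one_smul,
    LinearMap.id_apply, Pi.single_apply] at h
  rw [← h]
  conv_rhs => rw [pi_eq_sum_univ' (w j)]
  simp [dotProduct, mul_comm]

end LocalKer

/-! ### The total metric -/

namespace FermionRep

open Matrix

variable {n : ℕ} {H : Type*} [NormedAddCommGroup H] [InnerProductSpace ℂ H]
  [FiniteDimensional ℂ H] {F : FermionRep n H} {M : Matrix (Fin n) (Fin n) ℂ}
  {η : Module.End ℂ H}

lemma IsTotalMetric.mul_raise (hη : F.IsTotalMetric M η) (g : Fin n → ℂ) :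
    η * F.raise g = F.raise (M *ᵥ g) * η := by
  simp only [raise_apply, Finset.mul_sum, mul_smul_comm, hη.1, Finset.smul_sum, mulVec,
    dotProduct, Finset.sum_mul, smul_mul_assoc, Finset.sum_smul, smul_smul]
  rw [Finset.sum_comm]
  exact Finset.sum_congr rfl fun i _ => Finset.sum_congr rfl fun j _ => by rw [mul_comm]

/-- The difference `D` of the two sides satisfies `D a†(g) = -a†(M g) D` and kills the vacuum, so it
vanishes by cyclicity. -/
lemma IsTotalMetric.lower_mul (hη : F.IsTotalMetric M η) (f : Fin n → ℂ) :
    F.lower f * η = η * F.lower (Mᵀ *ᵥ f) := by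
  have key : ∀ g, (F.lower f * η - η * F.lower (Mᵀ *ᵥ f)) * F.raise g =
      -(F.raise (M *ᵥ g) * (F.lower f * η - η * F.lower (Mᵀ *ᵥ f))) := by
    intro g
    have h₁ := eq_sub_of_add_eq (F.lower_mul_raise f (M *ᵥ g))
    have h₂ := eq_sub_of_add_eq (F.lower_mul_raise (Mᵀ *ᵥ f) g)
    have h₃ : (Mᵀ *ᵥ f) ⬝ᵥ g = f ⬝ᵥ (M *ᵥ g) := by
      rw [mulVec_transpose, dotProduct_mulVec]
    rw [sub_mul, mul_assoc, hη.mul_raise, ← mul_assoc, h₁, mul_assoc, h₂, h₃, mul_sub, mul_sub,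
      sub_mul, ← mul_assoc η, hη.mul_raise]
    simp only [smul_mul_assoc, mul_smul_comm, one_mul, mul_one, mul_assoc]
    abel
  have htop : LinearMap.ker (F.lower f * η - η * F.lower (Mᵀ *ᵥ f)) = ⊤ := by
    refine F.eq_top_of_vac_mem ?_ fun i ψ hψ => ?_
    · simp [hη.2, lower_vac]
    · have h := LinearMap.congr_fun (key (Pi.single i 1)) ψ
      rw [raise_single, Module.End.mul_apply] at h
      rw [LinearMap.mem_ker] at hψ ⊢
      rw [h, LinearMap.neg_apply, Module.End.mul_apply, hψ]
      simp
  exact sub_eq_zero.mp (LinearMap.ker_eq_top.mp htop)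

/-- The range of the metric contains the vacuum and is stable under the creators, since `M` is
invertible; so it is everything. -/
lemma IsTotalMetric.isUnit (hη : F.IsTotalMetric M η) (hM : IsUnit M.det) : IsUnit η := by
  rw [Module.End.isUnit_iff]
  have htop : LinearMap.range η = ⊤ := by
    refine F.eq_top_of_vac_mem ⟨_, hη.2⟩ ?_
    rintro i _ ⟨ψ, rfl⟩
    refine ⟨F.raise (M⁻¹ *ᵥ Pi.single i 1) ψ, ?_⟩
    have h := LinearMap.congr_fun (hη.mul_raise (M⁻¹ *ᵥ Pi.single i 1)) ψ
    rw [mulVec_mulVec, Matrix.mul_nonsing_inv _ hM, one_mulVec, raise_single] at h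
    exact h
  have hs : Function.Surjective η := LinearMap.range_eq_top.mp htop
  exact ⟨LinearMap.injective_iff_surjective.mpr hs, hs⟩

lemma adjoint_list_prod_map {ι : Type*} (x : ι → Module.End ℂ H) (l : List ι) :
    LinearMap.adjoint (l.map x).prod =
      (l.reverse.map fun i => LinearMap.adjoint (x i)).prod := by
  induction l with
  | nil =>
    simp [Module.End.one_eq_id]
  | cons i l ih =>
    rw [List.map_cons, List.prod_cons, Module.End.mul_eq_comp, LinearMap.adjoint_comp, ih]
    simp [Module.End.mul_eq_comp]

lemma adjoint_monomial {m : ℕ} (x y : Fin m → Module.End ℂ H) (S₁ S₂ : Finset (Fin m)) :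
    LinearMap.adjoint (prodIncr S₁ x * prodDecr S₂ y) =
      prodIncr S₂ (fun i => LinearMap.adjoint (y i)) *
        prodDecr S₁ (fun i => LinearMap.adjoint (x i)) := by
  rw [Module.End.mul_eq_comp, LinearMap.adjoint_comp, ← Module.End.mul_eq_comp, prodIncr, prodDecr,
    adjoint_list_prod_map, adjoint_list_prod_map, List.reverse_reverse]
  rfl

lemma adjoint_create (f : Fin n → ℂ) : LinearMap.adjoint (F.create f) = F.annih f := by
  simp [create, annih, aDag, map_smulₛₗ]

lemma adjoint_annih (f : Fin n → ℂ) : LinearMap.adjoint (F.annih f) = F.create f := by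
  rw [← adjoint_create, LinearMap.adjoint_adjoint]

lemma IsBKLocal.adjoint {A : Finset (Fin n)} {O : Module.End ℂ H} (h : F.IsBKLocal A O) :
    F.IsBKLocal A (LinearMap.adjoint O) := by
  unfold IsBKLocal at h ⊢
  induction h using Submodule.span_induction with
  | mem O h =>
    obtain ⟨S₁, S₂, h₁, h₂, h, rfl⟩ := h
    refine Submodule.subset_span ⟨S₂, S₁, h₂, h₁, by rwa [add_comm], ?_⟩
    rw [adjoint_monomial]
    simp only [adjoint_aDag]
    rfl
  | zero => simp
  | add O O' _ _ h h' => rw [map_add]; exact Submodule.add_mem _ h h'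
  | smul r O _ h => rw [map_smulₛₗ]; exact Submodule.smul_mem _ _ h

/-! ### Local observables -/

/-- The generators with which an observable local to `A` commutes: besides those outside `A`, also
their transforms under the metric. -/
theorem IsBKLocal.commute_of_isQuasiHermitian (hM : M.PosDef) (hη : F.IsTotalMetric M η)
    {A : Finset (Fin n)} {O : Module.End ℂ H} (hO : F.IsBKLocal A O)
    (hq : IsQuasiHermitian η O) :
    (∀ f : Fin n → ℂ, (∀ x ∈ localKer M A, f ⬝ᵥ x = 0) → Commute O (F.lower f)) ∧
      (∀ g : Fin n → ℂ, (∀ x ∈ localKer M A, g ⬝ᵥ star (M *ᵥ x) = 0) →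
        Commute O (F.raise g)) := by
  have hdet : IsUnit M.det := (Matrix.isUnit_iff_isUnit_det _).mp hM.isUnit
  have hunit : IsUnit η := hη.isUnit hdet
  obtain ⟨-, hl, hr⟩ := F.isBKLocal_iff.mp hO
  obtain ⟨-, hl', hr'⟩ := F.isBKLocal_iff.mp hO.adjoint
  unfold IsQuasiHermitian at hq
  -- `η⁻¹ O† η = O` turns the commutation of `O†` with `a(f)` into that of `O` with `η⁻¹ a(f) η`.
  have transfer : ∀ {X Y : Module.End ℂ H}, Commute (LinearMap.adjoint O) X → X * η = η * Y →
      Commute O Y := by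
    intro X Y hX hXY
    refine hunit.mul_left_cancel ?_
    rw [← mul_assoc, hq, mul_assoc, ← hXY, ← mul_assoc, hX.eq, mul_assoc, ← hq, ← mul_assoc, hXY,
      mul_assoc]
  have hlM : ∀ f : Fin n → ℂ, (∀ i ∈ A, f i = 0) → Commute O (F.lower (Mᵀ *ᵥ f)) :=
    fun f hf => transfer (hl' f hf) (hη.lower_mul f)
  have hrM : ∀ g : Fin n → ℂ, (∀ i ∈ A, g i = 0) → Commute O (F.raise (M⁻¹ *ᵥ g)) :=
    fun g hg => transfer (hr' g hg) (by
      rw [hη.mul_raise, mulVec_mulVec, Matrix.mul_nonsing_inv _ hdet, one_mulVec])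
  have hsingle : ∀ i ∉ A, ∀ j ∈ A, (Pi.single i 1 : Fin n → ℂ) j = 0 := by
    intro i hi j hj
    refine Pi.single_eq_of_ne ?_ _
    rintro rfl
    exact hi hj
  -- The space of `f` such that `O` commutes with `γ f`.
  let Q : ((Fin n → ℂ) →ₗ[ℂ] Module.End ℂ H) → Submodule ℂ (Fin n → ℂ) := fun γ =>
    LinearMap.ker ((LinearMap.mulLeft ℂ O - LinearMap.mulRight ℂ O) ∘ₗ γ)
  have hQ : ∀ γ f, f ∈ Q γ ↔ Commute O (γ f) := fun γ f => by
    simp [Q, sub_eq_zero, Commute, SemiconjBy]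
  constructor
  · intro f hf
    rw [← hQ]
    refine Submodule.mem_of_forall_dotProduct fun x hx => hf x fun i hi => ⟨?_, ?_⟩
    · simpa using hx _ ((hQ _ _).mpr (hl _ (hsingle i hi)))
    · have h := hx _ ((hQ _ _).mpr (hlM _ (hsingle i hi)))
      rw [mulVec_transpose, ← dotProduct_mulVec] at h
      simpa using h
  · intro g hg
    rw [← hQ]
    refine Submodule.mem_of_forall_dotProduct fun x hx => ?_
    have hMx : M *ᵥ (M⁻¹ *ᵥ star x) = star x := by
      rw [mulVec_mulVec, Matrix.mul_nonsing_inv _ hdet, one_mulVec]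
    have h := hg (M⁻¹ *ᵥ star x) fun i hi => ⟨?_, ?_⟩
    · rwa [hMx, star_star] at h
    · have h := hx _ ((hQ _ _).mpr (hrM _ (hsingle i hi)))
      have hstar : M⁻¹ *ᵥ star x = star (x ᵥ* M⁻¹) := by
        rw [Matrix.star_vecMul, hM.isHermitian.inv.eq]
      rw [dotProduct_comm, dotProduct_mulVec] at h
      rw [hstar]
      simpa using h
    · rw [hMx]
      have h := hx _ ((hQ _ _).mpr (hr _ (hsingle i hi)))
      simpa using h

/-- An observable local to `A` is local to every `S` with the same local kernel. -/
lemma IsBKLocal.of_localKer_le (hM : M.PosDef) (hη : F.IsTotalMetric M η)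
    {A S : Finset (Fin n)} {O : Module.End ℂ H} (hO : F.IsBKLocal A O)
    (hq : IsQuasiHermitian η O) (h : localKer M A ≤ localKer M S) : F.IsBKLocal S O := by
  obtain ⟨hl, hr⟩ := hO.commute_of_isQuasiHermitian hM hη hq
  refine F.isBKLocal_iff.mpr ⟨(F.isBKLocal_iff.mp hO).1, fun f hf => hl f fun x hx => ?_,
    fun g hg => hr g fun x hx => ?_⟩
  · refine Finset.sum_eq_zero fun i _ => ?_
    by_cases hi : i ∈ S
    · rw [hf i hi, zero_mul]
    · rw [(h hx i hi).1, mul_zero]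
  · refine Finset.sum_eq_zero fun i _ => ?_
    by_cases hi : i ∈ S
    · rw [hg i hi, zero_mul]
    · rw [Pi.star_apply, (h hx i hi).2, star_zero, mul_zero]

/-! ### Expansion of the local observables in monomials -/

/-- The metric exchanges a monomial in the `a†(w i)` and `a(M w i)` with the adjoint of the
monomial with the two index sets swapped. -/
lemma IsTotalMetric.mul_monomial (hη : F.IsTotalMetric M η) (hM : M.IsHermitian) {k : ℕ}
    (w : Fin k → Fin n → ℂ) (S₁ S₂ : Finset (Fin k)) :
    η * (prodIncr S₁ (fun i => F.create (w i)) * prodDecr S₂ (fun i => F.annih (M *ᵥ w i))) =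
      LinearMap.adjoint (prodIncr S₂ (fun i => F.create (w i)) *
        prodDecr S₁ (fun i => F.annih (M *ᵥ w i))) * η := by
  have h₁ : ∀ i, η * F.create (w i) = F.create (M *ᵥ w i) * η := fun i => hη.mul_raise _
  have h₂ : ∀ i, η * F.annih (M *ᵥ w i) = F.annih (w i) * η := fun i => by
    rw [annih_eq, annih_eq, hη.lower_mul, hM.star_mulVec_transpose]
  rw [adjoint_monomial]
  simp only [adjoint_create, adjoint_annih]
  rw [← mul_assoc, prodIncr, semiconj_list_prod_map h₁, mul_assoc, prodDecr,
    semiconj_list_prod_map h₂, ← mul_assoc]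
  rfl

lemma isBKLocal_of_mem_evenNormalSpan {A : Finset (Fin n)} {k : ℕ}
    {w : Fin k → Fin n → ℂ} (hw : ∀ i, w i ∈ localKer M A) {O : Module.End ℂ H}
    (hO : O ∈ evenNormalSpan Finset.univ (fun i => F.create (w i))
      (fun i => F.annih (M *ᵥ w i))) : F.IsBKLocal A O := by
  have hdot : ∀ x y : Fin n → ℂ, (∀ i ∈ A, x i = 0) → (∀ i ∉ A, y i = 0) → x ⬝ᵥ y = 0 := by
    intro x y hx hy
    refine Finset.sum_eq_zero fun i _ => ?_
    by_cases hi : i ∈ A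
    · rw [hx i hi, zero_mul]
    · rw [hy i hi, mul_zero]
  refine F.isBKLocal_iff.mpr ⟨commute_of_mem_evenNormalSpan (fun i _ => F.parity_mul_raise _)
    (fun i _ => F.parity_mul_lower _) hO, fun x hx => ?_, fun x hx => ?_⟩
  · refine (commute_of_mem_evenNormalSpan (fun i _ => ?_)
      (fun i _ => F.lower_anticomm _ _) hO).symm
    exact F.lower_mul_raise_anticomm (hdot _ _ hx fun j hj => (hw i j hj).1)
  · refine (commute_of_mem_evenNormalSpan (fun i _ => F.raise_anticomm _ _)
      (fun i _ => ?_) hO).symm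
    refine F.raise_mul_lower_anticomm (hdot _ _ hx fun j hj => ?_)
    simp [(hw i j hj).2]

/-- The vectors `star (M w i)` inherit a dual family from the `w i`. -/
lemma exists_dual_star_mulVec (hM : IsUnit M.det) {k : ℕ} {w f : Fin k → Fin n → ℂ}
    (hf : ∀ i j, f i ⬝ᵥ w j = if i = j then 1 else 0) :
    ∃ g : Fin k → Fin n → ℂ, ∀ i j, g i ⬝ᵥ star (M *ᵥ w j) = if i = j then 1 else 0 := by
  refine ⟨fun i => star (f i ᵥ* M⁻¹), fun i j => ?_⟩
  rw [star_dotProduct_star, dotProduct_comm, ← dotProduct_mulVec, mulVec_mulVec,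
    Matrix.nonsing_inv_mul _ hM, one_mulVec, hf]
  split_ifs <;> simp

/-- The local observables, expanded in a basis of the local kernel.  Averaging the
coefficients with those of `η⁻¹ O† η = O` makes them Hermitian, so linear independence of the
monomials plays no role. -/
theorem isBKLocal_and_isQuasiHermitian_iff (hM : M.PosDef) (hη : F.IsTotalMetric M η)
    {A : Finset (Fin n)} {k : ℕ} (b : Module.Basis (Fin k) ℂ (localKer M A))
    (O : Module.End ℂ H) :
    (F.IsBKLocal A O ∧ IsQuasiHermitian η O) ↔
      ∃ c : Finset (Fin k) → Finset (Fin k) → ℂ,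
        (∀ S₁ S₂, c S₁ S₂ = star (c S₂ S₁)) ∧
        (∀ S₁ S₂, Odd (S₁.card + S₂.card) → c S₁ S₂ = 0) ∧
        O = ∑ S₁, ∑ S₂, c S₁ S₂ •
          (prodIncr S₁ (fun i => F.create (b i : Fin n → ℂ)) *
            prodDecr S₂ (fun i => F.annih (M *ᵥ (b i : Fin n → ℂ)))) := by
  have hdet : IsUnit M.det := (Matrix.isUnit_iff_isUnit_det _).mp hM.isUnit
  set w : Fin k → Fin n → ℂ := fun i => b i
  set m : Finset (Fin k) → Finset (Fin k) → Module.End ℂ H := fun S₁ S₂ =>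
    prodIncr S₁ (fun i => F.create (w i)) * prodDecr S₂ (fun i => F.annih (M *ᵥ w i))
  have hm : ∀ S₁ S₂, η * m S₁ S₂ = LinearMap.adjoint (m S₂ S₁) * η :=
    hη.mul_monomial hM.isHermitian w
  -- The metric adjoint of a combination of monomials.
  have hadj : ∀ c : Finset (Fin k) → Finset (Fin k) → ℂ,
      LinearMap.adjoint (∑ S₁, ∑ S₂, c S₁ S₂ • m S₁ S₂) * η =
        η * ∑ S₁, ∑ S₂, star (c S₂ S₁) • m S₁ S₂ := by
    intro c
    rw [Finset.sum_comm]
    simp only [map_sum, map_smulₛₗ, Finset.sum_mul, Finset.mul_sum, smul_mul_assoc,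
      mul_smul_comm, hm]
    rfl
  constructor
  · rintro ⟨hO, hq⟩
    obtain ⟨hl, hr⟩ := hO.commute_of_isQuasiHermitian hM hη hq
    have hli : LinearIndependent ℂ w :=
      b.linearIndependent.map' (localKer M A).subtype (Submodule.ker_subtype _)
    obtain ⟨f, hf⟩ := hli.exists_dotProduct_dual
    obtain ⟨g, hg⟩ := exists_dual_star_mulVec hdet hf
    have hexp : ∀ x ∈ localKer M A, ∃ r : Fin k → ℂ, x = ∑ i, r i • w i := by
      intro x hx
      refine ⟨b.repr ⟨x, hx⟩, ?_⟩
      have e := congrArg Subtype.val (b.sum_repr ⟨x, hx⟩)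
      rw [Submodule.coe_sum] at e
      exact e.symm
    have hspan : O ∈ evenNormalSpan Finset.univ (fun i => F.create (w i))
        (fun i => F.annih (M *ᵥ w i)) := by
      refine F.mem_evenNormalSpan hf hg (F.isBKLocal_iff.mp hO).1 (fun x hx => hl x ?_)
        (fun x hx => hr x ?_)
      · intro y hy
        obtain ⟨r, rfl⟩ := hexp y hy
        rw [dotProduct_sum]
        exact Finset.sum_eq_zero fun i hi => by rw [dotProduct_smul, hx i hi, smul_zero]
      · intro y hy
        obtain ⟨r, rfl⟩ := hexp y hy
        rw [mulVec_sum, star_sum, dotProduct_sum]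
        exact Finset.sum_eq_zero fun i hi => by
          rw [mulVec_smul, star_smul, dotProduct_smul, hx i hi, smul_zero]
    obtain ⟨c, hc, e⟩ := exists_coeff_of_mem_evenNormalSpan hspan
    have e' : O = ∑ S₁, ∑ S₂, star (c S₂ S₁) • m S₁ S₂ := by
      refine (hη.isUnit hdet).mul_left_cancel ?_
      rw [← hadj]
      change O = ∑ S₁, ∑ S₂, c S₁ S₂ • m S₁ S₂ at e
      rw [← e]
      exact hq
    refine ⟨fun S₁ S₂ => (2⁻¹ : ℂ) * (c S₁ S₂ + star (c S₂ S₁)), fun S₁ S₂ => ?_,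
      fun S₁ S₂ h => ?_, ?_⟩
    · simp [add_comm]
    · simp [hc _ _ h, hc S₂ S₁ (by rwa [add_comm])]
    · simp only [mul_smul, add_smul, smul_add, Finset.sum_add_distrib, ← Finset.smul_sum]
      change O = ∑ S₁, ∑ S₂, c S₁ S₂ • m S₁ S₂ at e
      rw [← e, ← e', ← smul_add, ← two_smul ℂ O, smul_smul]
      simp
  · rintro ⟨c, hc, hodd, rfl⟩
    refine ⟨isBKLocal_of_mem_evenNormalSpan (fun i => (b i).2) ?_, ?_⟩
    · refine Submodule.sum_mem _ fun S₁ _ => Submodule.sum_mem _ fun S₂ _ => ?_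
      rcases Nat.even_or_odd (S₁.card + S₂.card) with h | h
      · exact Submodule.smul_mem _ _ (Submodule.subset_span
          ⟨S₁, S₂, Finset.subset_univ _, Finset.subset_univ _, h, rfl⟩)
      · rw [hodd _ _ h, zero_smul]
        exact Submodule.zero_mem _
    · rw [IsQuasiHermitian, hadj]
      simp only [← hc]
      rfl

/-- For a basis `w` of the local kernel of `A`, the observable `∑ i, a†(w i) a(M w i)` is local to
no `S ⊂ A` whose local kernel is smaller: if it were, it would commute with every `a(f)` orthogonal
to the local kernel of `S`, whence `∑ i, (f ⬝ w i) a(M w i) = 0` and `f` is orthogonal to all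
`w i`. -/
theorem exists_isBKExtensivelyLocal (hM : M.PosDef) (hη : F.IsTotalMetric M η)
    {A : Finset (Fin n)} (h : ∀ S ⊂ A, kerDim M S < kerDim M A) :
    ∃ O : Module.End ℂ H, F.IsBKExtensivelyLocal A O ∧ IsQuasiHermitian η O := by
  have hdet : IsUnit M.det := (Matrix.isUnit_iff_isUnit_det _).mp hM.isUnit
  let b := Module.finBasis ℂ (localKer M A)
  have hli : LinearIndependent ℂ fun i => (b i : Fin n → ℂ) :=
    b.linearIndependent.map' (localKer M A).subtype (Submodule.ker_subtype _)
  obtain ⟨f, hf⟩ := hli.exists_dotProduct_dual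
  obtain ⟨g, hg⟩ := exists_dual_star_mulVec hdet hf
  let O : Module.End ℂ H :=
    ∑ i, F.create (b i : Fin n → ℂ) * F.annih (M *ᵥ (b i : Fin n → ℂ))
  have hterm : ∀ i, F.create (b i : Fin n → ℂ) * F.annih (M *ᵥ (b i : Fin n → ℂ)) =
      prodIncr {i} (fun i => F.create (b i : Fin n → ℂ)) *
        prodDecr {i} (fun i => F.annih (M *ᵥ (b i : Fin n → ℂ))) := fun i => by
    simp [prodIncr, prodDecr]
  have hq : IsQuasiHermitian η O := by
    simp only [IsQuasiHermitian, O, hterm, map_sum, Finset.mul_sum, Finset.sum_mul]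
    exact Finset.sum_congr rfl fun i _ => hη.mul_monomial hM.isHermitian _ _ _
  refine ⟨O, ⟨isBKLocal_of_mem_evenNormalSpan (fun i => (b i).2) ?_, fun S hS hO => ?_⟩, hq⟩
  · refine Submodule.sum_mem _ fun i _ => Submodule.subset_span
      ⟨{i}, {i}, Finset.subset_univ _, Finset.subset_univ _, by simp, hterm i⟩
  · refine (h S hS).not_ge ?_
    rw [← finrank_localKer, ← finrank_localKer]
    refine Submodule.finrank_mono fun x hx => ?_
    refine Submodule.mem_of_forall_dotProduct fun y hy => ?_
    have hc := (hO.commute_of_isQuasiHermitian hM hη hq).1 y fun q hq => by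
      rw [dotProduct_comm]; exact hy q hq
    have hsum : F.lower (∑ i, (y ⬝ᵥ (b i : Fin n → ℂ)) • star (M *ᵥ (b i : Fin n → ℂ))) = 0 := by
      have e : F.lower y * O - O * F.lower y =
          F.lower (∑ i, (y ⬝ᵥ (b i : Fin n → ℂ)) • star (M *ᵥ (b i : Fin n → ℂ))) := by
        simp only [O, Finset.mul_sum, Finset.sum_mul, map_sum, map_smul,
          ← Finset.sum_sub_distrib, create_eq, annih_eq]
        refine Finset.sum_congr rfl fun i _ => ?_
        rw [← mul_assoc, eq_sub_of_add_eq (F.lower_mul_raise y (b i)), sub_mul, mul_assoc,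
          mul_assoc, F.lower_anticomm y]
        simp
      rw [← e, hc.eq, sub_self]
    have hzero : ∀ i, y ⬝ᵥ (b i : Fin n → ℂ) = 0 := by
      intro i
      have e := F.lower_mul_raise
        (∑ j, (y ⬝ᵥ (b j : Fin n → ℂ)) • star (M *ᵥ (b j : Fin n → ℂ))) (g i)
      rw [hsum, dotProduct_comm, dotProduct_sum] at e
      simp only [dotProduct_smul, hg, zero_mul, mul_zero, add_zero, smul_eq_mul, mul_ite, mul_one,
        Finset.sum_ite_eq, Finset.mem_univ, if_true] at e
      have e' := LinearMap.congr_fun e F.vac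
      have hvac : F.vac ≠ 0 := fun h0 => by simpa [h0] using F.norm_vac
      simpa [hvac] using e'.symm
    have e := congrArg Subtype.val (b.sum_repr ⟨x, hx⟩)
    rw [dotProduct_comm, ← show _ = x from e]
    simp only [Submodule.coe_sum, Submodule.coe_smul, dotProduct_sum, dotProduct_smul, hzero,
      smul_zero, Finset.sum_const_zero]

end FermionRep

theorem theorem4 {n : ℕ} {H : Type*} [NormedAddCommGroup H] [InnerProductSpace ℂ H]
    [FiniteDimensional ℂ H] (F : FermionRep n H)
    (M : Matrix (Fin n) (Fin n) ℂ) (hM : M.PosDef)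
    (η : Module.End ℂ H) (hη : F.IsTotalMetric M η) (A : Finset (Fin n)) :
    ((∃ O : Module.End ℂ H, F.IsBKExtensivelyLocal A O ∧ IsQuasiHermitian η O) ↔
      ∀ S : Finset (Fin n), S ⊂ A → kerDim M S < kerDim M A) ∧
    ∀ (w : Module.Basis (Fin (kerDim M A)) ℂ (offKer M A)) (O : Module.End ℂ H),
      (F.IsBKLocal A O ∧ IsQuasiHermitian η O) ↔
        ∃ c : Finset (Fin (kerDim M A)) → Finset (Fin (kerDim M A)) → ℂ,
          (∀ S₁ S₂, c S₁ S₂ = star (c S₂ S₁)) ∧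
          (∀ S₁ S₂, Odd (S₁.card + S₂.card) → c S₁ S₂ = 0) ∧
          O = ∑ S₁, ∑ S₂, c S₁ S₂ •
            (prodIncr S₁ (fun μ => F.create (extendZero A (w μ).val)) *
              prodDecr S₂ (fun ν =>
                F.annih (extendZero A ((diagBlock M A).mulVec (w ν).val)))) := by
  refine ⟨⟨?_, fun h => FermionRep.exists_isBKExtensivelyLocal hM hη h⟩, fun w O => ?_⟩
  · rintro ⟨O, ⟨hO, hext⟩, hq⟩ S hS
    by_contra! hle
    refine hext S hS (hO.of_localKer_le hM hη hq ?_)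
    rw [← finrank_localKer, ← finrank_localKer] at hle
    exact (Submodule.eq_of_le_of_finrank_le (localKer_mono M hS.subset) hle).ge
  · simp only [← fun ν => mulVec_extendZero_eq (w ν).2]
    exact FermionRep.isBKLocal_and_isQuasiHermitian_iff hM hη (w.map (offKerEquiv M A)) O
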